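/- For positive integers $w\le n$, let $J(n,w)$ be the Johnson graph: its vertices are the $w$-subsets of an $n$-set, two of them being adjacent iff their intersection has $w-1$ elements. A set $C$ of vertices is an $e$-perfect code in $J(n,w)$ if every vertex is at graph distance at most $e$ from exactly one element of $C$. Such a code is called trivial if it is the whole vertex set (with $e=0$), or consists of a single vertex (with $w\le n-w$ and $e\ge w$), or is a pair of disjoint $w$-subsets with $n=2w$, $w$ odd and $e=(w-1)/2$. For integers $m\ge 0$ put $$w_m=\frac{(1+\sqrt2)^{2m+1}+(1-\sqrt2)^{2m+1}+6}{4},\qquad \gamma_m=\sqrt2\left((1+\sqrt2)^{2m}-(1-\sqrt2)^{2m}\right)+1 .$$ (i) For $0\le m\le 10000$, the number $\gamma_m$ is the square of an integer if and only if $m\in\{0,1,2\}$. For these values $\gamma_0=1$, $\gamma_1=9$, $\gamma_2=49$ and $w_0=2$, $w_1=5$, $w_2=22$. (ii) For every integer $w$ with $1\le w\le 1.97\times10^{7655}$, there is no nontrivial $2$-perfect code in $J(2w,w)$. -/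

import Mathlib

/-- Vertices of the Johnson graph: the `w`-subsets of an `n`-set. -/
abbrev JohnsonSpace (n w : ℕ) : Type := {s : Finset (Fin n) // s.card = w}

/-- The Johnson graph `J(n,w)`: two `w`-subsets are adjacent iff they meet in `w - 1` elements. -/
def johnsonGraph (n w : ℕ) : SimpleGraph (JohnsonSpace n w) where
  Adj s t := (s.1 ∩ t.1).card + 1 = w
  symm := ⟨fun s t h => by rwa [Finset.inter_comm] at h⟩
  loopless := ⟨fun s h => by
    rw [Finset.inter_self, s.2] at h
    omega⟩

/-- `C` is an `e`-perfect code in `J(n,w)`: every vertex is within graph distance `e` of exactly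
one codeword. -/
def IsPerfectCode (n w e : ℕ) (C : Set (JohnsonSpace n w)) : Prop :=
  ∀ v : JohnsonSpace n w, ∃! c : JohnsonSpace n w, c ∈ C ∧ (johnsonGraph n w).dist v c ≤ e

/-- The trivial perfect codes: the whole space (radius `0`); a single word when `w ≤ n - w`
(radius `w`, hence also any larger radius); a pair of disjoint words when `n = 2w`, `w` is odd
and the radius is `(w - 1) / 2`. -/
def IsTrivialPerfectCode (n w e : ℕ) (C : Set (JohnsonSpace n w)) : Prop :=
  (e = 0 ∧ C = Set.univ) ∨
  (2 * w ≤ n ∧ w ≤ e ∧ ∃ v : JohnsonSpace n w, C = {v}) ∨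
  (n = 2 * w ∧ w = 2 * e + 1 ∧
    ∃ u v : JohnsonSpace n w, Disjoint u.1 v.1 ∧ C = {u, v})

/-- `w_m = ((1 + √2)^(2m+1) + (1 - √2)^(2m+1) + 6) / 4`. -/
noncomputable def pellWeight (m : ℕ) : ℝ :=
  ((1 + √2) ^ (2 * m + 1) + (1 - √2) ^ (2 * m + 1) + 6) / 4

/-- `γ_m = √2 ((1 + √2)^(2m) - (1 - √2)^(2m)) + 1`. -/
noncomputable def pellGamma (m : ℕ) : ℝ :=
  √2 * ((1 + √2) ^ (2 * m) - (1 - √2) ^ (2 * m)) + 1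

/-! In Pell numbers, `γ_m = 4 P_{2m} + 1` and `2 w_m - 3 = P_{2m} + P_{2m+1}`. Part (i) is a
quadratic residue sieve: Pell numbers are periodic modulo each prime, and a few small primes
eliminate every index below 13860 except 0, 1, 2 (`eq_of_isSquare_pell`).

For (ii), let `X = raiseOp ∘ lowerOp` on functions of `w`-subsets, `w = k + 2`. Its eigenvalues have
the form `j (j + 1)`, and four times the radius-2 ball sum is a quadratic in `X`
(`four_mul_ballSum`). The indicator of a perfect code minus a constant is a nonzero function in the
kernel of the ball sum, so some `j (j + 1)` is a root: `(j (j + 1) - u) ^ 2 = (u ^ 2 + 1) / 2` with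
`u = 2 w - 3`. This negative Pell equation gives `u = P_{2m} + P_{2m+1}`, and `j (j + 1)` is
`P_{2m}` or `P_{2m+2}`, so `γ_m` or `γ_{m+1}` is the square `(2 j + 1) ^ 2`. By (i), `w` is 2, 5 or
22. The first two weights allow only trivial codes, and 22 violates sphere packing. -/

/-! ### Closed forms in terms of Pell numbers -/

/-- The pair `(P_{2m}, P_{2m+1})` of consecutive Pell numbers. -/
def pellPair : ℕ → ℕ × ℕ
  | 0 => (0, 1)
  | m + 1 => ((pellPair m).1 + 2 * (pellPair m).2, 2 * (pellPair m).1 + 5 * (pellPair m).2)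

theorem one_add_sqrt_two_pow (m : ℕ) :
    (1 + √2) ^ (2 * m) = ((pellPair m).2 - (pellPair m).1 : ℝ) + (pellPair m).1 * √2 := by
  have h2 : √2 * √2 = (2 : ℝ) := Real.mul_self_sqrt (by norm_num)
  induction m with
  | zero => simp [pellPair]
  | succ m ih =>
    rw [mul_add, pow_add, ih, pellPair]
    push_cast
    linear_combination (((pellPair m).2 : ℝ) + (pellPair m).1 + (pellPair m).1 * √2) * h2

theorem one_sub_sqrt_two_pow (m : ℕ) :
    (1 - √2) ^ (2 * m) = ((pellPair m).2 - (pellPair m).1 : ℝ) - (pellPair m).1 * √2 := by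
  have h2 : √2 * √2 = (2 : ℝ) := Real.mul_self_sqrt (by norm_num)
  induction m with
  | zero => simp [pellPair]
  | succ m ih =>
    rw [mul_add, pow_add, ih, pellPair]
    push_cast
    linear_combination (((pellPair m).2 : ℝ) + (pellPair m).1 - (pellPair m).1 * √2) * h2

theorem pellGamma_eq (m : ℕ) : pellGamma m = ((4 * (pellPair m).1 + 1 : ℕ) : ℝ) := by
  have h2 : √2 * √2 = (2 : ℝ) := Real.mul_self_sqrt (by norm_num)
  rw [pellGamma, one_add_sqrt_two_pow, one_sub_sqrt_two_pow]
  push_cast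
  linear_combination (2 * (pellPair m).1 : ℝ) * h2

theorem pellWeight_eq (m : ℕ) :
    pellWeight m = (((pellPair m).1 + (pellPair m).2 : ℝ) + 3) / 2 := by
  have h2 : √2 * √2 = (2 : ℝ) := Real.mul_self_sqrt (by norm_num)
  rw [pellWeight, pow_succ, pow_succ, one_add_sqrt_two_pow, one_sub_sqrt_two_pow]
  linear_combination ((pellPair m).1 / 2 : ℝ) * h2

/-! ### Pell numbers modulo primes -/

theorem pellPair_add_modEq {N d : ℕ} (h1 : (pellPair d).1 ≡ 0 [MOD N])
    (h2 : (pellPair d).2 ≡ 1 [MOD N]) (m : ℕ) :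
    (pellPair (m + d)).1 ≡ (pellPair m).1 [MOD N] ∧
      (pellPair (m + d)).2 ≡ (pellPair m).2 [MOD N] := by
  induction m with
  | zero => simpa [pellPair] using ⟨h1, h2⟩
  | succ m ih =>
    rw [Nat.add_right_comm]
    simp only [pellPair]
    exact ⟨ih.1.add (ih.2.mul_left 2), (ih.1.mul_left 2).add (ih.2.mul_left 5)⟩

theorem pellPair_mod_modEq {N d : ℕ} (h1 : (pellPair d).1 ≡ 0 [MOD N])
    (h2 : (pellPair d).2 ≡ 1 [MOD N]) (m : ℕ) :
    (pellPair m).1 ≡ (pellPair (m % d)).1 [MOD N] := by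
  have key : ∀ k r : ℕ, (pellPair (r + d * k)).1 ≡ (pellPair r).1 [MOD N] := by
    intro k r
    induction k with
    | zero => rfl
    | succ k ih =>
      rw [mul_add_one, ← add_assoc]
      exact (pellPair_add_modEq h1 h2 (r + d * k)).1.trans ih
  simpa [Nat.mod_add_div] using key (m / d) (m % d)

/-- Fermat: a square is `0` or `1` modulo `p` after raising it to the power `(p - 1) / 2`. -/
theorem sq_pow_half_mod {p k : ℕ} (hp : p.Prime) (hodd : p % 2 = 1) :
    (k ^ 2) ^ (p / 2) % p = 0 ∨ (k ^ 2) ^ (p / 2) % p = 1 := by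
  have hp2 := hp.two_le
  have e : 2 * (p / 2) = p - 1 := by omega
  rw [← pow_mul, e]
  by_cases h : p ∣ k
  · left
    exact Nat.mod_eq_zero_of_dvd (h.trans (dvd_pow_self k (by omega)))
  · right
    have := Nat.ModEq.pow_totient ((Nat.Prime.coprime_iff_not_dvd hp).2 h).symm
    rw [Nat.totient_prime hp] at this
    rw [this, Nat.mod_eq_of_lt hp2]

/-- `m` passes the quadratic residue test modulo `p`, read off at the index `m % d`. -/
def pellTest (p d m : ℕ) : Bool :=
  ((4 * (pellPair (m % d)).1 + 1) % p) ^ (p / 2) % p ≤ 1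

theorem pellTest_of_isSquare {p d m : ℕ} (hp : p.Prime) (hodd : p % 2 = 1)
    (h1 : (pellPair d).1 % p = 0) (h2 : (pellPair d).2 % p = 1)
    (hm : IsSquare (4 * (pellPair m).1 + 1)) : pellTest p d m = true := by
  obtain ⟨k, hk⟩ := hm
  have h := ((pellPair_mod_modEq (N := p) (by simpa [Nat.ModEq] using h1)
    (by rw [Nat.ModEq, h2, Nat.mod_eq_of_lt hp.one_lt]) m).mul_left 4).add_right 1
  rw [hk, ← pow_two] at h
  have h' := (h.pow (p / 2)).symm
  have := sq_pow_half_mod (k := k) hp hodd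
  rw [pellTest, decide_eq_true_eq, ← Nat.pow_mod, h']
  omega

/-- Odd primes together with the period of `pellPair` modulo them. -/
def sievePrimes : List (ℕ × ℕ) :=
  [(5, 6), (11, 12), (3, 4), (19, 20), (269, 30), (31, 15), (13, 14), (83, 84), (113, 28),
    (23, 11), (89, 44), (43, 44), (353, 11), (199, 9), (61, 62), (131, 132)]

theorem sievePrimes_spec : ∀ q ∈ sievePrimes, q.1.Prime ∧ q.1 % 2 = 1 ∧
    (pellPair q.2).1 % q.1 = 0 ∧ (pellPair q.2).2 % q.1 = 1 := by
  have hp : ∀ q ∈ sievePrimes, q.1.Prime := by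
    simp only [sievePrimes, List.forall_mem_cons, List.not_mem_nil, false_imp_iff, implies_true,
      and_true]
    norm_num
  have h : ∀ q ∈ sievePrimes, q.1 % 2 = 1 ∧
      (pellPair q.2).1 % q.1 = 0 ∧ (pellPair q.2).2 % q.1 = 1 := by
    decide +kernel
  exact fun q hq => ⟨hp q hq, h q hq⟩

/-- The residues modulo `L * q` that lie over `S` and pass the tests in `T`. -/
def sieveStep (T : List (ℕ × ℕ)) (L q : ℕ) (S : List ℕ) : List ℕ :=
  (S.flatMap fun r => (List.range q).map fun i => r + L * i).filter
    fun r => T.all fun t => pellTest t.1 t.2 r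

theorem mod_mem_sieveStep {T : List (ℕ × ℕ)} {L q m : ℕ} {S : List ℕ} (hq : 0 < q)
    (hT : ∀ t ∈ T, t ∈ sievePrimes ∧ t.2 ∣ L * q)
    (hm : IsSquare (4 * (pellPair m).1 + 1)) (hS : m % L ∈ S) :
    m % (L * q) ∈ sieveStep T L q S := by
  simp only [sieveStep, List.mem_filter, List.mem_flatMap, List.mem_map, List.mem_range,
    List.all_eq_true]
  refine ⟨⟨m % L, hS, m / L % q, Nat.mod_lt _ hq, (Nat.mod_mul).symm⟩, fun t ht => ?_⟩
  obtain ⟨hp, ho, h1, h2⟩ := sievePrimes_spec t (hT t ht).1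
  have := pellTest_of_isSquare hp ho h1 h2 hm
  rwa [pellTest, Nat.mod_mod_of_dvd _ (hT t ht).2]

theorem eq_of_isSquare_pell {m : ℕ} (hlt : m < 13860)
    (hm : IsSquare (4 * (pellPair m).1 + 1)) : m = 0 ∨ m = 1 ∨ m = 2 := by
  have h0 : m % 1 ∈ [0] := by simp [Nat.mod_one]
  have h1 := mod_mem_sieveStep (T := [(5, 6), (11, 12), (3, 4)]) (q := 12) (by norm_num)
    (by decide) hm h0
  have h2 := mod_mem_sieveStep (T := [(19, 20), (269, 30), (31, 15)]) (q := 5) (by norm_num)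
    (by decide) hm h1
  have h3 := mod_mem_sieveStep (T := [(13, 14), (83, 84), (113, 28)]) (q := 7) (by norm_num)
    (by decide) hm h2
  have h4 := mod_mem_sieveStep (T := [(23, 11), (89, 44), (43, 44), (353, 11)]) (q := 11) (by norm_num)
    (by decide) hm h3
  have h5 := mod_mem_sieveStep (T := [(199, 9)]) (q := 3) (by norm_num)
    (by decide) hm h4
  -- The period 62 does not divide 13860, so this test is applied to `m` itself, which `m < 13860`
  -- makes equal to its residue.
  have h6 : pellTest 61 62 m = true ∧ pellTest 131 132 m = true := by
    constructor <;> exact (fun h => pellTest_of_isSquare h.1 h.2.1 h.2.2.1 h.2.2.2 hm)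
      (sievePrimes_spec (_, _) (by decide))
  have hfin : ∀ r ∈ sieveStep [(199, 9)] 4620 3 (sieveStep [(23, 11), (89, 44), (43, 44), (353, 11)]
      420 11 (sieveStep [(13, 14), (83, 84), (113, 28)] 60 7 (sieveStep [(19, 20), (269, 30),
      (31, 15)] 12 5 (sieveStep [(5, 6), (11, 12), (3, 4)] 1 12 [0])))),
      pellTest 61 62 r = true ∧ pellTest 131 132 r = true → r = 0 ∨ r = 1 ∨ r = 2 := by
    decide +kernel
  have e : m % (4620 * 3) = m := Nat.mod_eq_of_lt hlt
  exact hfin m (e ▸ h5) h6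

/-! ### The negative Pell equation -/

/-- Descent: the recursion of `pellPair` inverts to `(x, y) ↦ (5x - 2y, y - 2x)`. For `x > 0` the
equation keeps both entries nonnegative, and the second one decreases. -/
theorem exists_pellPair_eq {x y : ℕ} (h : (x + y) ^ 2 + 1 = 2 * y ^ 2) :
    ∃ m, pellPair m = (x, y) := by
  induction y using Nat.strong_induction_on generalizing x with
  | _ y ih =>
    rcases Nat.eq_zero_or_pos x with rfl | hx
    · exact ⟨0, by simp only [pellPair, Prod.mk.injEq, true_and]; nlinarith⟩
    · have h1 : 2 * x ≤ y := by by_contra! hc; nlinarith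
      have h2 : 2 * y ≤ 5 * x := by by_contra! hc; nlinarith
      obtain ⟨a, ha⟩ := Nat.exists_eq_add_of_le h1
      obtain ⟨b, hb⟩ := Nat.exists_eq_add_of_le h2
      obtain rfl : x = 2 * a + b := by omega
      subst ha
      obtain ⟨m, hm⟩ := ih a (by omega) (x := b) (by nlinarith)
      exact ⟨m + 1, by simp only [pellPair, hm]; congr 1 <;> ring⟩

/-- A rational growth rate 29/5, slightly below the true `3 + 2√2`. The ratio bound 5/12, slightly
above `√2 - 1`, is preserved by the recursion and makes the induction close. -/
theorem pow_le_pellPair (m : ℕ) :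
    12 * (pellPair m).1 ≤ 5 * (pellPair m).2 ∧
      29 ^ m ≤ 5 ^ m * ((pellPair m).1 + (pellPair m).2) := by
  induction m with
  | zero => simp [pellPair]
  | succ m ih =>
    obtain ⟨h1, h2⟩ := ih
    simp only [pellPair]
    refine ⟨by omega, ?_⟩
    calc 29 ^ (m + 1) = 29 * 29 ^ m := by ring
      _ ≤ 29 * (5 ^ m * ((pellPair m).1 + (pellPair m).2)) := by gcongr
      _ = 5 ^ m * (29 * ((pellPair m).1 + (pellPair m).2)) := by ring
      _ ≤ 5 ^ m * (5 * ((pellPair m).1 + 2 * (pellPair m).2 +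
          (2 * (pellPair m).1 + 5 * (pellPair m).2))) := Nat.mul_le_mul_left _ (by omega)
      _ = _ := by ring

theorem pellPair_sum_mono : Monotone fun m => (pellPair m).1 + (pellPair m).2 := by
  refine monotone_nat_of_le_succ fun m => ?_
  simp only [pellPair]
  omega

set_option exponentiation.threshold 20000 in
theorem lt_of_pellPair_sum_lt {m : ℕ} (h : (pellPair m).1 + (pellPair m).2 < 394 * 10 ^ 7653) :
    m < 10050 := by
  by_contra! hm
  -- An opaque `N` keeps the huge powers unevaluated until the kernel compares them.
  obtain ⟨N, hN⟩ : ∃ N, N = 10050 := ⟨_, rfl⟩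
  have h1 := lt_of_le_of_lt (pellPair_sum_mono (hN.trans_le hm)) h
  have h2 := (pow_le_pellPair N).2
  have h3 : 5 ^ N * (394 * 10 ^ 7653) < 29 ^ N := by
    rw [hN]
    decide +kernel
  have h4 := Nat.mul_lt_mul_of_pos_left h1 (pow_pos (by norm_num : 0 < 5) N)
  exact absurd (h4.trans h3) (not_lt.2 h2)

/-! ### Raising and lowering operators on functions of finite sets -/

section Operators

open Finset

variable {α : Type*} [Fintype α] [DecidableEq α]

/-- The operator summing a function over all one-element extensions of a set. -/
def lowerOp (f : Finset α → ℝ) (S : Finset α) : ℝ := ∑ x ∈ Sᶜ, f (insert x S)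

/-- The operator summing a function over all one-element deletions of a set. -/
def raiseOp (f : Finset α → ℝ) (S : Finset α) : ℝ := ∑ x ∈ S, f (S.erase x)

/-- Exchanging `x ∈ S` for `y ∉ S` gives the same set in either order. Only the moves returning to
`S` differ: `#Sᶜ` of them against `#S`. -/
theorem lowerOp_raiseOp (f : Finset α → ℝ) (S : Finset α) :
    lowerOp (raiseOp f) S =
      raiseOp (lowerOp f) S + ((Fintype.card α : ℝ) - 2 * #S) * f S := by
  have h1 : lowerOp (raiseOp f) S =
      #Sᶜ * f S + ∑ y ∈ Sᶜ, ∑ x ∈ S, f (insert y (S.erase x)) := by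
    rw [lowerOp, ← nsmul_eq_mul, ← sum_const, ← sum_add_distrib]
    refine sum_congr rfl fun y hy => ?_
    rw [mem_compl] at hy
    rw [raiseOp, sum_insert hy, erase_insert hy]
    congr 1
    refine sum_congr rfl fun x hx => ?_
    rw [erase_insert_of_ne (by rintro rfl; exact hy hx)]
  have h2 : raiseOp (lowerOp f) S =
      #S * f S + ∑ x ∈ S, ∑ y ∈ Sᶜ, f (insert y (S.erase x)) := by
    rw [raiseOp, ← nsmul_eq_mul, ← sum_const, ← sum_add_distrib]
    refine sum_congr rfl fun x hx => ?_
    rw [lowerOp, compl_erase, sum_insert (by simpa using hx), insert_erase hx]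
  rw [h1, h2, sum_comm, card_compl, Nat.cast_sub (card_le_univ S)]
  ring

/-- The eigenvalues of `raiseOp ∘ lowerOp` on functions of `k`-subsets. -/
theorem exists_eigenvalue_raiseOp_lowerOp (k : ℕ) (f : Finset α → ℝ) (μ : ℝ)
    (hf : ∀ S, #S = k → raiseOp (lowerOp f) S = μ * f S) (h0 : ∃ S, #S = k ∧ f S ≠ 0) :
    ∃ i ≤ k, μ = ((k : ℝ) - i) * (Fintype.card α - k - i + 1) := by
  induction k generalizing f μ with
  | zero =>
    obtain ⟨S, hS, hfS⟩ := h0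
    have := hf S hS
    rw [card_eq_zero] at hS
    subst hS
    exact ⟨0, le_rfl, by simpa [raiseOp, hfS] using this⟩
  | succ k ih =>
    by_cases hz : ∃ S, #S = k ∧ lowerOp f S ≠ 0
    -- A nonzero `lowerOp f` is an eigenfunction one level down, its eigenvalue shifted by the
    -- commutator; if it vanishes, `μ = 0`.
    · obtain ⟨i, hi, h⟩ := ih (lowerOp f) (μ - (Fintype.card α - 2 * k)) (fun S hS => by
        have h1 := lowerOp_raiseOp (lowerOp f) S
        have h2 : lowerOp (raiseOp (lowerOp f)) S = μ * lowerOp f S := by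
          rw [lowerOp, lowerOp, mul_sum]
          refine sum_congr rfl fun y hy => hf _ ?_
          rw [card_insert_of_notMem (mem_compl.1 hy), hS]
        rw [hS] at h1
        linear_combination h2 - h1) hz
      refine ⟨i, by omega, ?_⟩
      push_cast
      linear_combination h
    · push Not at hz
      obtain ⟨S, hS, hfS⟩ := h0
      refine ⟨k + 1, le_rfl, ?_⟩
      have h1 : raiseOp (lowerOp f) S = 0 :=
        sum_eq_zero fun x hx => hz _ (by rw [card_erase_of_mem hx, hS]; rfl)
      rw [hf S hS] at h1
      simpa [hfS] using h1

/-- The sum of a function over all extensions by `j` elements. -/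
def lowerSum (j : ℕ) (f : Finset α → ℝ) (S : Finset α) : ℝ :=
  ∑ T with S ⊆ T ∧ #S + j = #T, f T

/-- The sum of a function over all deletions of `j` elements. -/
def raiseSum (j : ℕ) (f : Finset α → ℝ) (S : Finset α) : ℝ :=
  ∑ R with R ⊆ S ∧ #R + j = #S, f R

theorem lowerSum_zero (f : Finset α → ℝ) : lowerSum 0 f = f := by
  ext S
  rw [lowerSum, sum_eq_single_of_mem S (by simp)]
  intro T hT hne
  rw [mem_filter] at hT
  exact absurd (eq_of_subset_of_card_le hT.2.1 (by omega)).symm hne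

theorem raiseSum_zero (f : Finset α → ℝ) : raiseSum 0 f = f := by
  ext S
  rw [raiseSum, sum_eq_single_of_mem S (by simp)]
  intro T hT hne
  rw [mem_filter] at hT
  exact absurd (eq_of_subset_of_card_le hT.2.1 (by omega)) hne

/-- Each `T` is reached once for each choice of the element of `T \ S` added first. Thus `lowerSum
j` acts as the divided power `lowerOp ^ j / j!`. -/
theorem lowerOp_lowerSum (j : ℕ) (f : Finset α → ℝ) (S : Finset α) :
    lowerOp (lowerSum j f) S = (j + 1) * lowerSum (j + 1) f S := by
  simp only [lowerOp, lowerSum]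
  rw [sum_comm' (t' := univ.filter fun T => S ⊆ T ∧ #S + (j + 1) = #T) (s' := fun T => T \ S),
    mul_sum]
  · refine sum_congr rfl fun T hT => ?_
    rw [mem_filter] at hT
    rw [sum_const, card_sdiff_of_subset hT.2.1, ← hT.2.2, nsmul_eq_mul]
    push_cast [Nat.add_sub_cancel_left]
    rfl
  · intro y T
    simp only [mem_compl, mem_filter, mem_univ, true_and, mem_sdiff, insert_subset_iff]
    constructor
    · rintro ⟨hy, ⟨hyT, hST⟩, hc⟩
      rw [card_insert_of_notMem hy] at hc
      exact ⟨⟨hyT, hy⟩, hST, by omega⟩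
    · rintro ⟨⟨hyT, hy⟩, hST, hc⟩
      rw [card_insert_of_notMem hy]
      exact ⟨hy, ⟨hyT, hST⟩, by omega⟩

theorem raiseOp_raiseSum (j : ℕ) (f : Finset α → ℝ) (S : Finset α) :
    raiseOp (raiseSum j f) S = (j + 1) * raiseSum (j + 1) f S := by
  simp only [raiseOp, raiseSum]
  rw [sum_comm' (t' := univ.filter fun R => R ⊆ S ∧ #R + (j + 1) = #S) (s' := fun R => S \ R),
    mul_sum]
  · refine sum_congr rfl fun R hR => ?_
    rw [mem_filter] at hR
    rw [sum_const, card_sdiff_of_subset hR.2.1, ← hR.2.2, nsmul_eq_mul]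
    push_cast [Nat.add_sub_cancel_left]
    rfl
  · intro y R
    simp only [mem_filter, mem_univ, true_and, mem_sdiff, subset_erase]
    constructor
    · rintro ⟨hy, ⟨hRS, hyR⟩, hc⟩
      rw [card_erase_of_mem hy] at hc
      have := card_pos.2 ⟨y, hy⟩
      exact ⟨⟨hy, hyR⟩, hRS, by omega⟩
    · rintro ⟨⟨hy, hyR⟩, hRS, hc⟩
      rw [card_erase_of_mem hy]
      exact ⟨hy, ⟨hRS, hyR⟩, by omega⟩

theorem lowerOp_eq (f : Finset α → ℝ) : lowerOp f = lowerSum 1 f := by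
  ext S
  simpa [lowerSum_zero] using lowerOp_lowerSum 0 f S

theorem raiseOp_eq (f : Finset α → ℝ) : raiseOp f = raiseSum 1 f := by
  ext S
  simpa [raiseSum_zero] using raiseOp_raiseSum 0 f S

theorem raiseOp_const_mul {β : Type*} [DecidableEq β] (c : ℝ) (f : Finset β → ℝ) :
    raiseOp (fun S => c * f S) = fun S => c * raiseOp f S := by
  ext S
  simp only [raiseOp, mul_sum]

/-- Double counting: `f T` occurs once for each `k`-subset of `S ∩ T`. -/
theorem raiseSum_lowerSum {j k : ℕ} (f : Finset α → ℝ) {S : Finset α} (hS : #S = k + j) :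
    raiseSum j (lowerSum j f) S = ∑ T with #T = #S, ((#(S ∩ T)).choose k : ℝ) * f T := by
  simp only [raiseSum, lowerSum]
  rw [sum_comm' (t' := univ.filter fun T => #T = #S)
    (s' := fun T => (S ∩ T).powersetCard k)]
  · exact sum_congr rfl fun T _ => by rw [sum_const, card_powersetCard, nsmul_eq_mul]
  · intro R T
    simp only [mem_filter, mem_univ, true_and, mem_powersetCard, subset_inter_iff]
    constructor
    · rintro ⟨⟨h1, h2⟩, h3, h4⟩
      exact ⟨⟨⟨h1, h3⟩, by omega⟩, by omega⟩
    · rintro ⟨⟨⟨h1, h3⟩, h2⟩, h4⟩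
      exact ⟨⟨h1, by omega⟩, h3, by omega⟩

/-- The sum of a function over the ball of radius two of the Johnson scheme. -/
def ballSum (f : Finset α → ℝ) (S : Finset α) : ℝ :=
  ∑ T with #T = #S ∧ #S ≤ #(S ∩ T) + 2, f T

/-- The ball of radius two in `J(2w, w)` is a quadratic polynomial in `raiseOp ∘ lowerOp`. -/
theorem four_mul_ballSum {k : ℕ} (hα : Fintype.card α = 2 * (k + 2)) (f : Finset α → ℝ)
    {S : Finset α} (hS : #S = k + 2) :
    4 * ballSum f S = raiseOp (lowerOp (raiseOp (lowerOp f))) S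
      - (4 * k + 2) * raiseOp (lowerOp f) S + 2 * (k + 1) * k * f S := by
  have e2 : raiseOp (raiseOp (lowerOp (lowerOp f))) S = 4 * raiseSum 2 (lowerSum 2 f) S := by
    have h1 : lowerOp (lowerOp f) = fun R => 2 * lowerSum 2 f R := by
      ext R
      rw [lowerOp_eq f, lowerOp_lowerSum]
      norm_num
    rw [h1, raiseOp_const_mul, raiseOp_const_mul, raiseOp_eq (lowerSum 2 f)]
    beta_reduce
    rw [raiseOp_raiseSum]
    push_cast
    ring
  have e3 : raiseOp (raiseOp (lowerOp (lowerOp f))) S =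
      raiseOp (lowerOp (raiseOp (lowerOp f))) S - 2 * raiseOp (lowerOp f) S := by
    rw [raiseOp, raiseOp.eq_1 (lowerOp (raiseOp (lowerOp f))), raiseOp.eq_1 (lowerOp f), mul_sum,
      ← sum_sub_distrib]
    refine sum_congr rfl fun x hx => ?_
    rw [lowerOp_raiseOp, card_erase_of_mem hx, hS, hα]
    push_cast [Nat.add_sub_cancel]
    ring
  have e1 : raiseOp (lowerOp f) S = raiseSum 1 (lowerSum 1 f) S := by
    rw [lowerOp_eq, raiseOp_eq]
  have e0 : f S = raiseSum 0 (lowerSum 0 f) S := by rw [lowerSum_zero, raiseSum_zero]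
  -- For `i ≤ k + 2`, `C(i,k) - k C(i,k+1) + k(k+1)/2 · C(i,k+2)` is 1 if `i ≥ k` and 0 otherwise:
  -- the indicator of the ball, with `i = #(S ∩ T)`.
  have key : ballSum f S = raiseSum 2 (lowerSum 2 f) S - k * raiseOp (lowerOp f) S
      + (k * (k + 1) / 2) * f S := by
    rw [e1, e0, raiseSum_lowerSum (k := k) f hS, raiseSum_lowerSum (k := k + 1) f hS,
      raiseSum_lowerSum (k := k + 2) f hS, mul_sum, mul_sum, ← sum_sub_distrib, ← sum_add_distrib,
      ballSum, ← filter_filter, sum_filter]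
    refine sum_congr rfl fun T hT => ?_
    have hle : #(S ∩ T) ≤ k + 2 := hS ▸ card_le_card inter_subset_left
    rw [hS]
    rcases (by omega : #(S ∩ T) < k ∨ #(S ∩ T) = k ∨ #(S ∩ T) = k + 1 ∨ #(S ∩ T) = k + 2) with
      h | h | h | h
    · rw [if_neg (by omega), Nat.choose_eq_zero_of_lt h, Nat.choose_eq_zero_of_lt (by omega),
        Nat.choose_eq_zero_of_lt (by omega)]
      simp
    · rw [if_pos (by omega), h, Nat.choose_self, Nat.choose_succ_self,
        Nat.choose_eq_zero_of_lt (by omega)]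
      simp
    · rw [if_pos (by omega), h, Nat.choose_succ_self_right, Nat.choose_self,
        Nat.choose_succ_self]
      push_cast
      ring
    · rw [if_pos (by omega), h, Nat.choose_self, Nat.choose_succ_self_right,
        ← Nat.choose_symm_of_eq_add (Nat.add_comm k 2), Nat.cast_choose_two]
      push_cast
      ring
  linear_combination 4 * key + e3 - e2

end Operators

/-! ### Perfect codes, the kernel of the ball sum, and sphere packing -/

section Kernel

open Finset

variable {α : Type*} [Fintype α] [DecidableEq α]

theorem raiseOp_lowerOp_sub_const_mul (f g : Finset α → ℝ) (c : ℝ) (S : Finset α) :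
    raiseOp (lowerOp fun T => g T - c * f T) S =
      raiseOp (lowerOp g) S - c * raiseOp (lowerOp f) S := by
  simp only [raiseOp, lowerOp, sum_sub_distrib, mul_sum]

theorem raiseOp_lowerOp_one (S : Finset α) :
    raiseOp (lowerOp fun _ => 1) S = #S * ((Fintype.card α : ℝ) - #S + 1) := by
  rw [raiseOp, sum_congr rfl (g := fun _ => (Fintype.card α : ℝ) - #S + 1), sum_const,
    nsmul_eq_mul]
  intro x hx
  rw [lowerOp, sum_const, nsmul_eq_mul, compl_erase, card_insert_of_notMem (by simpa using hx),
    card_compl]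
  push_cast [Nat.cast_sub (card_le_univ S)]
  ring

theorem raiseOp_lowerOp_congr {f g : Finset α → ℝ} {S : Finset α}
    (h : ∀ T, #T = #S → f T = g T) : raiseOp (lowerOp f) S = raiseOp (lowerOp g) S := by
  refine sum_congr rfl fun x hx => sum_congr rfl fun y hy => h _ ?_
  rw [card_insert_of_notMem (mem_compl.1 hy), card_erase_add_one hx]

/-- Four times the size of a ball of radius two in `J(2k + 4, k + 2)`. -/
def fourBallSize (k : ℕ) : ℕ := (k + 2) * (k + 3) * (k ^ 2 + k + 4) + 2 * k * (k + 1)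

theorem four_mul_ballSum_one {k : ℕ} (hα : Fintype.card α = 2 * (k + 2)) {S : Finset α}
    (hS : #S = k + 2) : 4 * ballSum (fun _ => 1) S = fourBallSize k := by
  have h1 : ∀ T : Finset α, #T = k + 2 → raiseOp (lowerOp fun _ => 1) T =
      -- The eigenvalue `(k + 2)(k + 3)` of constants, in the form `g - c * f` needed to apply
      -- `raiseOp ∘ lowerOp` a second time.
      0 - (-((k + 2 : ℝ) * (k + 3))) * 1 := by
    intro T hT
    rw [raiseOp_lowerOp_one, hT, hα]
    push_cast
    ring
  rw [four_mul_ballSum hα _ hS, raiseOp_lowerOp_congr (fun T hT => h1 T (hT.trans hS)),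
    raiseOp_lowerOp_sub_const_mul (fun _ => 1) (fun _ => 0), h1 S hS, fourBallSize]
  simp only [raiseOp, lowerOp, sum_const_zero]
  push_cast
  ring

/-- A function in the kernel of the ball sum exists only if some `j * (j + 1)` is a root of the
quadratic polynomial of `four_mul_ballSum`. -/
theorem exists_root_of_ballSum_eq_zero {k : ℕ} (hα : Fintype.card α = 2 * (k + 2))
    (f : Finset α → ℝ) (hf : ∀ S, #S = k + 2 → ballSum f S = 0)
    (h0 : ∃ S, #S = k + 2 ∧ f S ≠ 0) :
    ∃ j : ℕ, ((j : ℝ) * (j + 1) - (2 * k + 1)) ^ 2 = 2 * k ^ 2 + 2 * k + 1 := by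
  have eig : ∀ (g : Finset α → ℝ) (μ : ℝ), (μ - (2 * k + 1)) ^ 2 = 2 * k ^ 2 + 2 * k + 1 →
      (∀ S, #S = k + 2 → raiseOp (lowerOp g) S = μ * g S) → (∃ S, #S = k + 2 ∧ g S ≠ 0) →
      ∃ j : ℕ, ((j : ℝ) * (j + 1) - (2 * k + 1)) ^ 2 = 2 * k ^ 2 + 2 * k + 1 := by
    intro g μ hμ hg hg0
    obtain ⟨i, hi, h⟩ := exists_eigenvalue_raiseOp_lowerOp (k + 2) g μ hg hg0
    refine ⟨k + 2 - i, ?_⟩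
    rw [← hμ, h, hα, Nat.cast_sub hi]
    push_cast
    ring
  have hs : √(2 * k ^ 2 + 2 * k + 1 : ℝ) ^ 2 = 2 * k ^ 2 + 2 * k + 1 :=
    Real.sq_sqrt (by positivity)
  set s := √(2 * k ^ 2 + 2 * k + 1 : ℝ)
  -- With the quadratic factored as `(X - r₊)(X - r₋)`, either `(X - r₋) f` is an eigenfunction for
  -- `r₊`, or it vanishes and `f` is one for `r₋`.
  by_cases hz : ∃ S, #S = k + 2 ∧ raiseOp (lowerOp f) S - (2 * k + 1 - s) * f S ≠ 0
  · refine eig _ (2 * k + 1 + s) (by rw [add_sub_cancel_left, hs]) (fun S hS => ?_) hz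
    rw [raiseOp_lowerOp_sub_const_mul]
    have h1 := four_mul_ballSum hα f hS
    rw [hf S hS] at h1
    linear_combination -h1 - f S * hs
  · push Not at hz
    exact eig f (2 * k + 1 - s) (by rw [sub_sub_cancel_left, neg_sq, hs])
      (fun S hS => sub_eq_zero.1 (hz S hS)) h0

theorem ballSum_sub_const (f : Finset α → ℝ) (c : ℝ) (S : Finset α) :
    ballSum (fun T => f T - c) S = ballSum f S - c * ballSum (fun _ => 1) S := by
  simp only [ballSum, sum_sub_distrib, mul_sum, mul_one]

/-- Subtracting the reciprocal of the ball size puts `f` in the kernel. That constant lies strictly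
between 0 and 1, so the difference vanishes nowhere. -/
theorem exists_root_of_ballSum_eq_one {k : ℕ} (hα : Fintype.card α = 2 * (k + 2))
    (f : Finset α → ℝ) (hf : ∀ S, #S = k + 2 → ballSum f S = 1) (h01 : ∀ S, f S = 0 ∨ f S = 1) :
    ∃ j : ℕ, ((j : ℝ) * (j + 1) - (2 * k + 1)) ^ 2 = 2 * k ^ 2 + 2 * k + 1 := by
  have hB : (4 : ℝ) < fourBallSize k := by
    have : 4 < fourBallSize k := by rw [fourBallSize]; nlinarith
    exact_mod_cast this
  obtain ⟨S, -, hS⟩ := exists_subset_card_eq (s := (univ : Finset α)) (n := k + 2)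
    (by rw [card_univ, hα]; omega)
  refine exists_root_of_ballSum_eq_zero hα (fun T => f T - 4 / fourBallSize k) (fun T hT => ?_)
    ⟨S, hS, ?_⟩
  · have h1 := four_mul_ballSum_one hα hT
    rw [ballSum_sub_const, hf T hT]
    have : (fourBallSize k : ℝ) ≠ 0 := by linarith
    field_simp
    linarith
  · have h1 : 0 < 4 / (fourBallSize k : ℝ) := by positivity
    have h2 : 4 / (fourBallSize k : ℝ) < 1 := (div_lt_one (by linarith)).2 hB
    rcases h01 S with h | h <;> rw [h]
    · linarith
    · linarith

/-- The sphere packing equality. -/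
theorem four_mul_choose_eq {k : ℕ} (hα : Fintype.card α = 2 * (k + 2))
    (f : Finset α → ℝ) (hf : ∀ S, #S = k + 2 → ballSum f S = 1) :
    4 * ((2 * (k + 2)).choose (k + 2) : ℝ) =
      fourBallSize k * ∑ T with #T = k + 2, f T := by
  have h1 : ∑ S with #S = k + 2, ballSum f S = ((2 * (k + 2)).choose (k + 2) : ℝ) := by
    rw [sum_congr rfl (g := fun _ => (1 : ℝ)) fun S hS => hf S (by simpa using hS), sum_const,
      nsmul_one, ← hα, ← card_univ, ← card_powersetCard]
    congr 2
    ext S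
    simp [mem_powersetCard]
  have h2 : ∑ S with #S = k + 2, ballSum f S =
      ∑ T with #T = k + 2, f T * ballSum (fun _ => 1) T := by
    simp only [ballSum, mul_sum, mul_one]
    refine sum_comm' fun S T => ?_
    simp only [mem_filter, mem_univ, true_and, inter_comm S T]
    omega
  rw [← h1, h2, mul_sum, mul_sum]
  refine sum_congr rfl fun T hT => ?_
  rw [← four_mul_ballSum_one hα (by simpa using hT : #T = k + 2)]
  ring

end Kernel

/-! ### From a root to the Pell equation -/

/-- A perfect square `(j (j + 1) - u) ^ 2 = (u ^ 2 + 1) / 2` leads to a Pell number. -/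
theorem eq_of_root {k j : ℕ} (hk : 2 * k + 1 < 394 * 10 ^ 7653)
    (h : ((j : ℝ) * (j + 1) - (2 * k + 1)) ^ 2 = 2 * k ^ 2 + 2 * k + 1) :
    k = 0 ∨ k = 3 ∨ k = 20 := by
  have hlt : ∀ m, (pellPair m).1 + (pellPair m).2 = 2 * k + 1 → m < 10050 :=
    fun m e => lt_of_pellPair_sum_lt (e.trans_lt hk)
  -- Keeps the huge literal away from the later `omega` calls.
  clear hk
  have hZ : ((j : ℤ) * (j + 1) - (2 * k + 1)) ^ 2 = 2 * k ^ 2 + 2 * k + 1 := by exact_mod_cast h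
  have main : ∀ y x : ℕ, x + y = 2 * k + 1 → y ^ 2 = 2 * k ^ 2 + 2 * k + 1 →
      (j * (j + 1) = x ∨ j * (j + 1) = x + 2 * y) → k = 0 ∨ k = 3 ∨ k = 20 := by
    intro y x hxy hy hj
    obtain ⟨m, hm⟩ := exists_pellPair_eq (x := x) (y := y) (by rw [hxy, hy]; ring)
    have hm_lt := hlt m (by rw [hm]; exact hxy)
    have h012 : m = 0 ∨ m = 1 ∨ m = 2 := by
      rcases hj with hj | hj
      · exact eq_of_isSquare_pell (by omega) ⟨2 * j + 1, by rw [hm]; simp only [← hj]; ring⟩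
      -- The larger root `x + 2 * y` is `P_{2m+2}`, the next index.
      · have := eq_of_isSquare_pell (m := m + 1) (by omega)
          ⟨2 * j + 1, by simp only [pellPair, hm, ← hj]; ring⟩
        omega
    rcases h012 with rfl | rfl | rfl <;> simp [pellPair] at hm <;> omega
  -- Ensures that the natural subtraction defining `x` below is not truncated.
  have hle : ((j : ℤ) * (j + 1) - (2 * k + 1)).natAbs ≤ 2 * k + 1 := by
    zify
    refine abs_le_of_sq_le_sq (by rw [hZ]; nlinarith) (by positivity)
  refine main ((j : ℤ) * (j + 1) - (2 * k + 1)).natAbs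
    (2 * k + 1 - ((j : ℤ) * (j + 1) - (2 * k + 1)).natAbs) (by omega) ?_ ?_
  · zify
    rw [sq_abs, hZ]
  · generalize hμ : j * (j + 1) = μ
    have : (j : ℤ) * (j + 1) = μ := by exact_mod_cast hμ
    rw [this] at hle ⊢
    omega

/-! ### Distances in the Johnson graph -/

section Graph

open Finset

variable {n w : ℕ}

theorem johnsonGraph_le_card_inter_add_length {s t : JohnsonSpace n w}
    (p : (johnsonGraph n w).Walk s t) : w ≤ #(s.1 ∩ t.1) + p.length := by
  induction p with
  | @nil u => rw [inter_self, u.2]; omega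
  | @cons u v t h p ih =>
    have h1 : #(u.1 ∩ v.1) + 1 = w := h
    have h2 : #(v.1 ∩ t.1) ≤ #(u.1 ∩ t.1) + #(v.1 \ u.1) := by
      refine (card_le_card fun x hx => ?_).trans (card_union_le _ _)
      simp only [mem_inter, mem_union, mem_sdiff] at hx ⊢
      tauto
    have h3 := card_sdiff_add_card_inter v.1 u.1
    rw [inter_comm, v.2] at h3
    rw [SimpleGraph.Walk.length_cons]
    omega

theorem johnsonGraph_exists_walk (k : ℕ) {s t : JohnsonSpace n w} (h : #(s.1 ∩ t.1) + k = w) :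
    ∃ p : (johnsonGraph n w).Walk s t, p.length = k := by
  induction k generalizing s with
  | zero =>
    have h1 : s.1 ∩ t.1 = s.1 := eq_of_subset_of_card_le inter_subset_left (by rw [s.2]; omega)
    have h2 : s.1 ∩ t.1 = t.1 := eq_of_subset_of_card_le inter_subset_right (by rw [t.2]; omega)
    obtain rfl : s = t := Subtype.ext (h1.symm.trans h2)
    exact ⟨.nil, rfl⟩
  | succ k ih =>
    have h1 := card_sdiff_add_card_inter s.1 t.1
    have h2 := card_sdiff_add_card_inter t.1 s.1
    rw [s.2] at h1
    rw [t.2, inter_comm] at h2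
    obtain ⟨x, hx⟩ := card_pos.1 (by omega : 0 < #(s.1 \ t.1))
    obtain ⟨y, hy⟩ := card_pos.1 (by omega : 0 < #(t.1 \ s.1))
    rw [mem_sdiff] at hx hy
    have hys : y ∉ s.1.erase x := fun h => hy.2 (mem_of_mem_erase h)
    have hpos := card_pos.2 ⟨x, hx.1⟩
    have hc : #(insert y (s.1.erase x)) = w := by
      rw [card_insert_of_notMem hys, card_erase_add_one hx.1, s.2]
    obtain ⟨p, hp⟩ := ih (s := ⟨insert y (s.1.erase x), hc⟩) (by
      have : insert y (s.1.erase x) ∩ t.1 = insert y (s.1 ∩ t.1) := by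
        rw [insert_inter_of_mem hy.1, erase_inter, erase_eq_of_notMem]
        simp [hx.2]
      dsimp only
      rw [this, card_insert_of_notMem (by simp [hy.2])]
      omega)
    have hadj : (johnsonGraph n w).Adj s ⟨insert y (s.1.erase x), hc⟩ := by
      change #(s.1 ∩ insert y (s.1.erase x)) + 1 = w
      rw [inter_insert_of_notMem hy.2, inter_eq_right.2 (erase_subset _ _),
        card_erase_add_one hx.1, s.2]
    exact ⟨.cons hadj p, by rw [SimpleGraph.Walk.length_cons, hp]⟩

/-- An edge changes the intersection with `t` by at most one, and exchanging elements attains this.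
The explicit walk also gives reachability, without which `dist` would be 0 by default. -/
theorem johnsonGraph_dist_le_iff {s t : JohnsonSpace n w} {d : ℕ} :
    (johnsonGraph n w).dist s t ≤ d ↔ w ≤ #(s.1 ∩ t.1) + d := by
  have hle : #(s.1 ∩ t.1) ≤ w := (card_le_card inter_subset_left).trans_eq s.2
  obtain ⟨p, hp⟩ := johnsonGraph_exists_walk (s := s) (t := t) (w - #(s.1 ∩ t.1)) (by omega)
  constructor
  · intro h
    obtain ⟨q, hq⟩ := p.reachable.exists_walk_length_eq_dist
    have := johnsonGraph_le_card_inter_add_length q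
    omega
  · intro h
    have := SimpleGraph.dist_le p
    omega

theorem johnsonGraph_exists_between {s t : JohnsonSpace n w} {a b : ℕ}
    (h : w ≤ #(s.1 ∩ t.1) + (a + b)) : ∃ r : JohnsonSpace n w,
    (johnsonGraph n w).dist r s ≤ a ∧ (johnsonGraph n w).dist r t ≤ b := by
  have hle : #(s.1 ∩ t.1) ≤ w := (card_le_card inter_subset_left).trans_eq s.2
  obtain ⟨p, hp⟩ := johnsonGraph_exists_walk (s := s) (t := t) (w - #(s.1 ∩ t.1)) (by omega)
  refine ⟨p.getVert a, ?_, ?_⟩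
  · rw [SimpleGraph.dist_comm]
    refine (SimpleGraph.dist_le (p.take a)).trans ?_
    simp
  · refine (SimpleGraph.dist_le (p.drop a)).trans ?_
    simp
    omega

open Classical in
/-- The indicator function of a code, as a function on all finite sets. -/
noncomputable def codeIndicator (C : Set (JohnsonSpace n w)) (S : Finset (Fin n)) : ℝ :=
  if ∃ c ∈ C, c.1 = S then 1 else 0

theorem codeIndicator_eq (C : Set (JohnsonSpace n w)) (S : Finset (Fin n)) :
    codeIndicator C S = 0 ∨ codeIndicator C S = 1 := by
  rw [codeIndicator]
  split_ifs <;> simp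

theorem IsPerfectCode.ballSum_eq_one {C : Set (JohnsonSpace n w)} (hC : IsPerfectCode n w 2 C)
    {S : Finset (Fin n)} (hS : #S = w) : ballSum (codeIndicator C) S = 1 := by
  obtain ⟨c, ⟨hc, hd⟩, huniq⟩ := hC ⟨S, hS⟩
  rw [johnsonGraph_dist_le_iff] at hd
  rw [ballSum, sum_eq_single_of_mem c.1 (by simp [c.2, hS]; simpa using hd)]
  · exact if_pos ⟨c, hc, rfl⟩
  · intro T hT hne
    rw [mem_filter] at hT
    refine if_neg ?_
    rintro ⟨c', hc', rfl⟩
    refine hne (congrArg Subtype.val (huniq c' ⟨hc', ?_⟩))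
    rw [johnsonGraph_dist_le_iff]
    simpa [hS] using hT.2.2

theorem IsPerfectCode.eq_singleton {C : Set (JohnsonSpace n w)} (hC : IsPerfectCode n w 2 C)
    (hw : w ≤ 2) (v : JohnsonSpace n w) : ∃ c, C = {c} := by
  obtain ⟨c, ⟨hc, -⟩, huniq⟩ := hC v
  refine ⟨c, Set.eq_singleton_iff_unique_mem.2 ⟨hc, fun c' hc' => huniq c' ⟨hc', ?_⟩⟩⟩
  rw [johnsonGraph_dist_le_iff]
  omega

theorem IsPerfectCode.disjoint {C : Set (JohnsonSpace n 5)} (hC : IsPerfectCode n 5 2 C)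
    {c c' : JohnsonSpace n 5} (hc : c ∈ C) (hc' : c' ∈ C) (hne : c ≠ c') :
    Disjoint c.1 c'.1 := by
  by_contra hd
  rw [disjoint_iff_inter_eq_empty, ← card_eq_zero] at hd
  obtain ⟨r, h1, h2⟩ := johnsonGraph_exists_between (s := c) (t := c') (a := 2) (b := 2) (by omega)
  exact hne ((hC r).unique ⟨hc, h1⟩ ⟨hc', h2⟩)

theorem IsPerfectCode.eq_pair {C : Set (JohnsonSpace 10 5)} (hC : IsPerfectCode 10 5 2 C) :
    ∃ u v : JohnsonSpace 10 5, Disjoint u.1 v.1 ∧ C = {u, v} := by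
  have eq_compl : ∀ u v : JohnsonSpace 10 5, Disjoint u.1 v.1 → v.1 = u.1ᶜ := by
    intro u v h
    refine eq_of_subset_of_card_le (subset_compl_iff_disjoint_left.2 h) ?_
    rw [card_compl, u.2, v.2, Fintype.card_fin]
  obtain ⟨s, -, hs⟩ := exists_subset_card_eq (s := (univ : Finset (Fin 10))) (n := 5) (by simp)
  obtain ⟨u, ⟨hu, -⟩, -⟩ := hC ⟨s, hs⟩
  -- The complement of `u` is at distance 5 from `u`, so another codeword must cover it.
  obtain ⟨v, ⟨hv, hd⟩, -⟩ := hC ⟨u.1ᶜ, by rw [card_compl, u.2, Fintype.card_fin]⟩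
  have huv : u ≠ v := by
    rintro rfl
    rw [johnsonGraph_dist_le_iff, inter_comm] at hd
    simp at hd
  refine ⟨u, v, hC.disjoint hu hv huv, Set.ext fun x => ⟨fun hx => ?_, ?_⟩⟩
  · by_cases h : u = x
    · exact Or.inl h.symm
    · right
      exact Subtype.ext ((eq_compl u x (hC.disjoint hu hx h)).trans
        (eq_compl u v (hC.disjoint hu hv huv)).symm)
  · rintro (rfl | rfl)
    exacts [hu, hv]

/-- Four times the ball size is `215384 = 109 * 1976`, but the prime 109 exceeds 44 and cannot
divide `4 * C(44,22)`. -/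
theorem not_isPerfectCode_44_22 (C : Set (JohnsonSpace 44 22)) : ¬ IsPerfectCode 44 22 2 C := by
  intro hC
  have h := four_mul_choose_eq (α := Fin 44) (k := 20) (by simp) (codeIndicator C)
    fun S hS => hC.ballSum_eq_one hS
  classical
  have hsum : ∃ N : ℕ, ∑ T with #T = 20 + 2, codeIndicator C T = N :=
    ⟨_, by simp only [codeIndicator]; exact sum_boole _ _⟩
  obtain ⟨N, hN⟩ := hsum
  rw [hN] at h
  have h' : 4 * (2 * (20 + 2)).choose (20 + 2) = fourBallSize 20 * N := by exact_mod_cast h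
  have hp : Nat.Prime 109 := by norm_num
  have hdvd : 109 ∣ 4 * (44).choose 22 :=
    dvd_trans ⟨1976, by norm_num [fourBallSize]⟩ ⟨N, h'⟩
  rcases hp.dvd_mul.1 hdvd with h4 | h4
  · omega
  · have h5 : (44).choose 22 ∣ Nat.factorial 44 :=
      Dvd.intro _ (((mul_assoc _ _ _).symm).trans
        (Nat.choose_mul_factorial_mul_factorial (by norm_num : 22 ≤ 44)))
    exact absurd (hp.dvd_factorial.1 (h4.trans h5)) (by norm_num)

end Graph

theorem mainTheorem4 :
    (∀ m : ℕ, m ≤ 10000 →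
      ((∃ k : ℤ, pellGamma m = (k : ℝ) ^ 2) ↔ m = 0 ∨ m = 1 ∨ m = 2)) ∧
    (pellGamma 0 = 1 ∧ pellGamma 1 = 9 ∧ pellGamma 2 = 49) ∧
    (pellWeight 0 = 2 ∧ pellWeight 1 = 5 ∧ pellWeight 2 = 22) ∧
    (∀ w : ℕ, 1 ≤ w → (w : ℝ) ≤ 1.97 * 10 ^ 7655 →
      ¬ ∃ C : Set (JohnsonSpace (2 * w) w),
        IsPerfectCode (2 * w) w 2 C ∧ ¬ IsTrivialPerfectCode (2 * w) w 2 C) := by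
  refine ⟨fun m hm => ⟨?_, ?_⟩, ?_, ?_, ?_⟩
  · rintro ⟨k, hk⟩
    rw [pellGamma_eq] at hk
    refine eq_of_isSquare_pell (by omega) ⟨k.natAbs, ?_⟩
    zify
    rw [abs_mul_abs_self, ← pow_two]
    exact_mod_cast hk
  · rintro (rfl | rfl | rfl) <;> simp only [pellGamma_eq, pellPair]
    exacts [⟨1, by norm_num⟩, ⟨3, by norm_num⟩, ⟨7, by norm_num⟩]
  · simp only [pellGamma_eq, pellPair]
    norm_num
  · simp only [pellWeight_eq, pellPair]
    norm_num
  · rintro w hw hle ⟨C, hC, hnt⟩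
    have single : w ≤ 2 → False := by
      intro hw2
      obtain ⟨s, -, hs⟩ := Finset.exists_subset_card_eq (s := (Finset.univ : Finset (Fin (2 * w))))
        (n := w) (by rw [Finset.card_univ, Fintype.card_fin]; omega)
      exact hnt (Or.inr (Or.inl ⟨le_rfl, hw2, hC.eq_singleton hw2 ⟨s, hs⟩⟩))
    rcases Nat.lt_or_ge w 2 with hlt | hge
    · exact single hlt.le
    · obtain ⟨k, rfl⟩ := Nat.exists_eq_add_of_le' hge
      obtain ⟨j, hj⟩ := exists_root_of_ballSum_eq_one (k := k) (Fintype.card_fin _)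
        (codeIndicator C) (fun S hS => hC.ballSum_eq_one hS) (codeIndicator_eq C)
      have hk : 2 * k + 1 < 394 * 10 ^ 7653 := by
        have e : (1.97 * 10 ^ 7655 : ℝ) = 197 * 10 ^ 7653 := by
          rw [pow_add 10 7653 2]
          generalize (10 : ℝ) ^ 7653 = t
          ring
        rw [e] at hle
        have h1 : k + 2 ≤ 197 * 10 ^ 7653 := by exact_mod_cast hle
        generalize 10 ^ 7653 = t at h1 ⊢
        omega
      rcases eq_of_root hk hj with rfl | rfl | rfl
      · exact single le_rfl
      · exact hnt (Or.inr (Or.inr ⟨rfl, rfl, IsPerfectCode.eq_pair hC⟩))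
      · exact not_isPerfectCode_44_22 C hC
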